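/- For a metric space $\mathcal H$ with distance $|p-q|$, write $\langle p,q\rangle_o=\tfrac12\left(|p-o|+|q-o|-|p-q|\right)$ for the Gromov product. Let $\delta$ be a real number. We call $\mathcal H$ $\delta$-hyperbolic if it is geodesic (any two points are joined by an isometrically embedded interval) and $$\langle x,z\rangle_o\ \ge\ \min\left(\langle x,y\rangle_o,\langle y,z\rangle_o\right)-\delta\qquad\text{for all }x,y,z,o\in\mathcal H .$$ If a group $G$ acts on $\mathcal H$ by isometries, its minimal displacement is $\inf\{|g\cdot p-p| : g\in G\setminus\{1\},\ p\in\mathcal H\}\in[0,\infty]$ (equal to $\infty$ if $G$ is trivial). Theorem. Let $n\ge 0$ be an integer, let $\mathbb K$ be a finite field and let $G$ be a finitely generated group that acts by isometries on a non-empty $\delta$-hyperbolic space $\mathcal H$ with minimal displacement greater than $(2n+11)^2\delta$. Then the group $\mathrm{GL}_n(\mathbb K[G])$ of invertible $n\times n$ matrices over the group algebra $\mathbb K[G]$ is finitely generated. -/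

import Mathlib

/-- A metric space is geodesic if any two of its points are joined by a geodesic segment,
i.e. by an isometrically embedded interval of length `dist x y`. -/
def IsGeodesicSpace (X : Type*) [MetricSpace X] : Prop :=
  ∀ x y : X, ∃ γ : ℝ → X, γ 0 = x ∧ γ (dist x y) = y ∧
    ∀ s ∈ Set.Icc 0 (dist x y), ∀ t ∈ Set.Icc 0 (dist x y), dist (γ s) (γ t) = |s - t|

/-- The Gromov product `⟨p, q⟩_r` of `p` and `q` with respect to the base point `r`. -/
noncomputable def gromovProduct {X : Type*} [MetricSpace X] (p q r : X) : ℝ :=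
  (1 / 2) * (dist p r + dist q r - dist p q)

/-- A `δ`-hyperbolic space in the sense of Gromov: a geodesic metric space in which
`⟨x, z⟩_o ≥ min (⟨x, y⟩_o) (⟨y, z⟩_o) - δ` for all points `x`, `y`, `z` and all base points `o`.
(For a non-empty space, `x = y = z = o` gives `0 ≤ δ`.) -/
structure IsHyperbolicSpace (X : Type*) [MetricSpace X] (δ : ℝ) : Prop where
  geodesic : IsGeodesicSpace X
  gromov_ineq : ∀ o x y z : X,
    min (gromovProduct x y o) (gromovProduct y z o) - δ ≤ gromovProduct x z o

/-- The minimal displacement of an action of `G` on `X`: the infimum of the distances between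
`g • p` and `p`, over all `g ≠ 1` in `G` and all points `p` (it is `∞` if `G` is trivial). -/
noncomputable def minDisplacement (G X : Type*) [Group G] [MetricSpace X] [MulAction G X] :
    ENNReal :=
  ⨅ (g : G) (_ : g ≠ 1) (p : X), edist (g • p) p

/-! Gaussian elimination works over `K[G]` because the group algebra has a weak division algorithm
(`exists_reduction`). Given a nontrivial left relation `∑ l i * x i = 0` between at most `n` nonzero
elements, some `x i` can be replaced by a combination of all of them, with a trivial unit as
coefficient of `x i`, that is zero or has a support of smaller orbit diameter. The rows of `A⁻¹`
provide such relations for a column of `A`, so row operations shrink the column until one usable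
entry is left; it has a left inverse and is therefore a trivial unit. Hence elementary matrices and
trivial diagonal units generate; conjugating by the latter reduces the former to entry `1`, and
finitely many generators suffice.

The reduction is geometric (`exists_subfamily`). In a relation the translates `g • supp (x i)`, `g ∈
supp (l i)`, cancel. Take those linked to a farthest point by overlaps outside a ball around `o`. A
translate sharing an outside point with this cluster belongs to it, so the partial sum over the
cluster vanishes outside the ball. Two linked translates of one set, if large compared with the
others, would have centres too close for the displacement (`isolatedIndex`); so the largest set
occurs once, and its coefficient is a monomial. Hyperbolicity costs `δ` per index, not per link,
because a chain needs an isolated index only once (`linkBound`). A pigeonhole choice of the radius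
makes what remains inside the ball short. -/

/-! ### Chains of overlapping sets -/

section Chains

variable {ι Γ V : Type*}

/-- Two points are adjacent if they lie in a common set `M i g` whose index `i` belongs to `J`. -/
def Adjacent (M : ι → Γ → V → Prop) (J : Finset ι) (p q : V) : Prop :=
  ∃ i ∈ J, ∃ g, M i g p ∧ M i g q

/-- Two points are linked if they are joined by a chain of adjacent points. -/
def Linked (M : ι → Γ → V → Prop) (J : Finset ι) : V → V → Prop :=
  Relation.ReflTransGen (Adjacent M J)

theorem Linked.symm {M : ι → Γ → V → Prop} {J : Finset ι} {p q : V} (h : Linked M J p q) :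
    Linked M J q p := by
  induction h with
  | refl => exact Relation.ReflTransGen.refl
  | tail _ hbc ih =>
    obtain ⟨i, hi, g, hx, hy⟩ := hbc
    exact Relation.ReflTransGen.head ⟨i, hi, g, hy, hx⟩ ih

theorem Linked.mono {M N : ι → Γ → V → Prop} {J J' : Finset ι} (hJ : J ⊆ J')
    (hMN : ∀ i g p, M i g p → N i g p) {p q : V} (h : Linked M J p q) : Linked N J' p q := by
  induction h with
  | refl => exact Relation.ReflTransGen.refl
  | tail _ hbc ih =>
    obtain ⟨i, hi, g, hx, hy⟩ := hbc
    exact Relation.ReflTransGen.tail ih ⟨i, hJ hi, g, hMN _ _ _ hx, hMN _ _ _ hy⟩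

/-- The sets of index `j` that can be joined by a chain of sets with indices in `J` coincide. -/
def IsolatedIndex (M : ι → Γ → V → Prop) (J : Finset ι) (j : ι) : Prop :=
  ∀ g g' p p', M j g p → M j g' p' → Linked M J p p' → g = g'

/-- All sets of index `j` met by the chain coincide, so one can jump from the first visit to the
last inside a single set. -/
theorem Linked.insert_cases [DecidableEq ι] {M : ι → Γ → V → Prop} {J : Finset ι} {j : ι}
    (hj : IsolatedIndex M J j) {p q : V} (h : Linked M (insert j J) p q) :
    Linked M J p q ∨ ∃ g p₁ p₂, Linked M J p p₁ ∧ M j g p₁ ∧ M j g p₂ ∧ Linked M J p₂ q := by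
  induction h using Relation.ReflTransGen.head_induction_on with
  | refl => exact Or.inl Relation.ReflTransGen.refl
  | @head a c hac _ ih =>
    obtain ⟨i, hi, g, ha, hc⟩ := hac
    rcases Finset.mem_insert.1 hi with rfl | hi
    · refine Or.inr ?_
      rcases ih with ih | ⟨g', p₁, p₂, h1, h2, h3, h4⟩
      · exact ⟨g, a, c, Relation.ReflTransGen.refl, ha, hc, ih⟩
      · obtain rfl := hj _ _ _ _ hc h2 h1
        exact ⟨g, a, p₂, Relation.ReflTransGen.refl, ha, h3, h4⟩
    · have hac : Adjacent M J a c := ⟨i, hi, g, ha, hc⟩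
      rcases ih with ih | ⟨g', p₁, p₂, h1, h2, h3, h4⟩
      · exact Or.inl (Relation.ReflTransGen.head hac ih)
      · exact Or.inr ⟨g', p₁, p₂, Relation.ReflTransGen.head hac h1, h2, h3, h4⟩

end Chains

/-! ### Gromov products along chains -/

section Gromov

variable {X : Type*} [MetricSpace X]

theorem dist_eq_sub_gromovProduct (p q o : X) :
    dist p q = dist p o + dist q o - 2 * gromovProduct p q o := by
  unfold gromovProduct; ring

theorem IsHyperbolicSpace.le_gromovProduct {δ : ℝ} (h : IsHyperbolicSpace X δ) {o x y z : X}
    {v : ℝ} (hxy : v ≤ gromovProduct x y o) (hyz : v ≤ gromovProduct y z o) :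
    v - δ ≤ gromovProduct x z o := by
  have := h.gromov_ineq o x y z
  have := le_min hxy hyz
  linarith

/-- The four point inequality. -/
theorem IsHyperbolicSpace.dist_add_dist_le {δ : ℝ} (h : IsHyperbolicSpace X δ) (x y z w : X) :
    dist x z + dist y w ≤ max (dist x y + dist z w) (dist y z + dist x w) + 2 * δ := by
  have := h.gromov_ineq w x y z
  unfold gromovProduct at this
  rcases le_total (1 / 2 * (dist x w + dist y w - dist x y))
    (1 / 2 * (dist y w + dist z w - dist y z)) with h1 | h1
  · rw [min_eq_left h1] at this
    have := le_max_left (dist x y + dist z w) (dist y z + dist x w)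
    linarith
  · rw [min_eq_right h1] at this
    have := le_max_right (dist x y + dist z w) (dist y z + dist x w)
    linarith

theorem IsHyperbolicSpace.nonneg [Nonempty X] {δ : ℝ} (h : IsHyperbolicSpace X δ) : 0 ≤ δ := by
  obtain ⟨x⟩ := ‹Nonempty X›
  have := h.gromov_ineq x x x x
  simp [gromovProduct] at this
  exact this

theorem IsHyperbolicSpace.mono {δ δ' : ℝ} (h : IsHyperbolicSpace X δ) (hδ : δ ≤ δ') :
    IsHyperbolicSpace X δ' :=
  ⟨h.geodesic, fun o x y z => by have := h.gromov_ineq o x y z; linarith⟩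

theorem IsGeodesicSpace.exists_midpoint (h : IsGeodesicSpace X) (x y : X) :
    ∃ c, dist x c = dist x y / 2 ∧ dist y c = dist x y / 2 := by
  obtain ⟨γ, h0, h1, hγ⟩ := h x y
  have hd : 0 ≤ dist x y := dist_nonneg
  refine ⟨γ (dist x y / 2), ?_, ?_⟩
  · have := hγ 0 ⟨le_rfl, hd⟩ (dist x y / 2) ⟨by linarith, by linarith⟩
    rw [h0] at this
    rw [this, zero_sub, abs_neg, abs_of_nonneg (by linarith)]
  · have := hγ (dist x y) ⟨hd, le_rfl⟩ (dist x y / 2) ⟨by linarith, by linarith⟩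
    rw [h1] at this
    rw [this, abs_of_nonneg (by linarith)]
    ring

variable {ι Γ V : Type*}

/-- Along any chain of sets with indices in `J`, Gromov products that are at least `v` inside each
of the sets drop by at most `δ` per index. -/
def LinkBound (M : ι → Γ → V → Prop) (e : V → X) (o : X) (δ : ℝ) (J : Finset ι) : Prop :=
  ∀ v : ℝ, (∀ i ∈ J, ∀ g p q, M i g p → M i g q → v ≤ gromovProduct (e p) (e q) o) →
    ∀ p q, Linked M J p q → ∀ s, v ≤ gromovProduct (e q) s o →
      v - J.card * δ ≤ gromovProduct (e p) s o

/-- Induction on `J.card`, removing an index `j` that maximizes `d`. The bound for the rest isolates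
`j`; a chain then crosses `j` at most once, which costs one further `δ`. -/
theorem IsHyperbolicSpace.linkBound {δ : ℝ} (h : IsHyperbolicSpace X δ) (hδ : 0 ≤ δ)
    {M : ι → Γ → V → Prop} {e : V → X} {o : X} (d : ι → ℝ)
    (hM : ∀ J j, (∀ i ∈ J, d i ≤ d j) → LinkBound M e o δ J → IsolatedIndex M J j)
    (J : Finset ι) : LinkBound M e o δ J := by
  classical
  induction hn : J.card generalizing J with
  | zero =>
    obtain rfl := Finset.card_eq_zero.1 hn
    intro v _ p q hpq s hs
    have : p = q := by
      induction hpq with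
      | refl => rfl
      | tail _ hbc _ => obtain ⟨i, hi, _⟩ := hbc; simp at hi
    subst this
    simpa using hs
  | succ n ih =>
    obtain ⟨j, hj, hmax⟩ := J.exists_max_image d (Finset.card_pos.1 (by omega))
    have hcard : (J.erase j).card = n := by rw [Finset.card_erase_of_mem hj]; omega
    have hL := ih _ hcard
    have hI : IsolatedIndex M (J.erase j) j :=
      hM _ _ (fun i hi => hmax i (Finset.mem_of_mem_erase hi)) hL
    intro v hv p q hpq s hs
    have hv' : ∀ i ∈ J.erase j, ∀ g p q, M i g p → M i g q → v ≤ gromovProduct (e p) (e q) o :=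
      fun i hi => hv i (Finset.mem_of_mem_erase hi)
    rw [← Finset.insert_erase hj] at hpq
    have hL := hL v hv'
    rw [hcard] at hL
    rw [hn]
    push_cast
    rcases hpq.insert_cases hI with hpq | ⟨g, p₁, p₂, h1, h2, h3, h4⟩
    · have := hL _ _ hpq s hs
      linarith
    · have a := hL _ _ h1 (e p₂) (hv j hj g _ _ h2 h3)
      have b := hL _ _ h4 s hs
      have := h.le_gromovProduct a b
      linarith

end Gromov

/-! ### Orbit diameters, coarse centres and isolation of translates -/

section Orbit

variable {G H : Type*} [Group G] [MetricSpace H] [MulAction G H]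

/-- The diameter of the orbit points `g • o`, `g ∈ S`. -/
noncomputable def spread (o : H) (S : Finset G) : ℝ :=
  Metric.diam ((fun g : G => g • o) '' (S : Set G))

theorem dist_le_spread (o : H) {S : Finset G} {a b : G} (ha : a ∈ S) (hb : b ∈ S) :
    dist (a • o) (b • o) ≤ spread o S :=
  Metric.dist_le_diam_of_mem (S.finite_toSet.image _).isBounded
    (Set.mem_image_of_mem _ ha) (Set.mem_image_of_mem _ hb)

theorem spread_nonneg (o : H) (S : Finset G) : 0 ≤ spread o S := Metric.diam_nonneg

theorem spread_le (o : H) {S : Finset G} {C : ℝ} (hS : S.Nonempty)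
    (h : ∀ a ∈ S, ∀ b ∈ S, dist (a • o) (b • o) ≤ C) : spread o S ≤ C := by
  obtain ⟨a, ha⟩ := hS
  refine Metric.diam_le_of_forall_dist_le (dist_nonneg.trans (h a ha a ha)) ?_
  rintro _ ⟨x, hx, rfl⟩ _ ⟨y, hy, rfl⟩
  exact h x hx y hy

theorem exists_dist_eq_spread (o : H) {S : Finset G} (hS : S.Nonempty) :
    ∃ a ∈ S, ∃ b ∈ S, dist (a • o) (b • o) = spread o S := by
  obtain ⟨⟨a, b⟩, hab, hmax⟩ := (S ×ˢ S).exists_max_image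
    (fun x => dist (x.1 • o) (x.2 • o)) (hS.product hS)
  obtain ⟨ha, hb⟩ := Finset.mem_product.1 hab
  refine ⟨a, ha, b, hb, le_antisymm (dist_le_spread o ha hb) (spread_le o hS ?_)⟩
  intro x hx y hy
  exact hmax (x, y) (Finset.mem_product.2 ⟨hx, hy⟩)

variable {ι : Type*}

/-- `p` lies in the translate by `g ∈ L i` of the set `X i`, at distance more than `ρ` from the
base point. -/
def HighMem (X L : ι → Finset G) (o : H) (ρ : ℝ) (i : ι) (g p : G) : Prop :=
  g ∈ L i ∧ g⁻¹ * p ∈ X i ∧ ρ < dist (p • o) o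

variable [IsIsometricSMul G H]

/-- A coarse centre of a finite set: every translate of the set that stays within distance `R` of
the base point lies in a ball of radius about half its diameter around the translated centre. -/
theorem IsHyperbolicSpace.exists_center {δ : ℝ} (h : IsHyperbolicSpace H δ) (o : H)
    {S : Finset G} (hS : S.Nonempty) :
    ∃ c : H, ∀ (g : G) (R : ℝ), (∀ a ∈ S, dist ((g * a) • o) o ≤ R) →
      (∀ a ∈ S, dist ((g * a) • o) (g • c) ≤ spread o S / 2 + 2 * δ) ∧
        dist (g • c) o ≤ R - spread o S / 2 + 2 * δ := by
  -- The centre is the midpoint of a diametral pair; both estimates are four-point inequalities for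
  -- this pair.
  obtain ⟨a, ha, b, hb, hab⟩ := exists_dist_eq_spread o hS
  obtain ⟨c, hac, hbc⟩ := h.geodesic.exists_midpoint (a • o) (b • o)
  rw [hab] at hac hbc
  refine ⟨c, fun g R hR => ⟨fun x hx => ?_, ?_⟩⟩
  · rw [mul_smul, dist_smul]
    have h1 := h.dist_add_dist_le (x • o) (a • o) c (b • o)
    have h2 := dist_le_spread o hx ha
    have h3 := dist_le_spread o hx hb
    rw [hab, dist_comm c (b • o), hac, hbc] at h1
    have := max_le_max (add_le_add_left h2 (spread o S / 2))
      (add_le_add_right h3 (spread o S / 2))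
    rw [add_comm (spread o S / 2) (spread o S), max_self] at this
    linarith
  · have h1 := h.dist_add_dist_le (g • c) ((g * a) • o) o ((g * b) • o)
    have h2 := hR a ha
    have h3 := hR b hb
    rw [mul_smul, mul_smul, dist_smul, dist_smul, dist_smul, dist_comm c, dist_comm c, hab, hac,
      hbc, dist_comm o, ← mul_smul, ← mul_smul] at h1
    have := max_le_max (add_le_add_right h3 (spread o S / 2))
      (add_le_add_left h2 (spread o S / 2))
    rw [add_comm R, max_self] at this
    linarith

theorem HighMem.dist_le {X L : ι → Finset G} {o : H} {ρ ρ' : ℝ} {i : ι} {g p q : G}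
    (hp : HighMem X L o ρ i g p) (hq : HighMem X L o ρ' i g q) :
    dist (p • o) (q • o) ≤ spread o (X i) := by
  have := dist_le_spread o hp.2.1 hq.2.1
  rwa [mul_smul, mul_smul, dist_smul] at this

/-- If two translates of `X j` are linked, the chain carries a large Gromov product from one centre
`g • c` to the other. Both centres are within about `R - spread o (X j) / 2` of `o`, so they are
within `T` of each other, which `hT` forbids. -/
theorem IsHyperbolicSpace.isolatedIndex {δ T R ρ η : ℝ} (h : IsHyperbolicSpace H δ)
    (hT : ∀ g : G, g ≠ 1 → ∀ p : H, T < dist (g • p) p) {X L : ι → Finset G} {o : H}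
    (hR : ∀ i, ∀ g ∈ L i, ∀ a ∈ X i, dist ((g * a) • o) o ≤ R)
    {M : ι → G → G → Prop} (hM : ∀ i g p, M i g p → HighMem X L o ρ i g p)
    (hδ : 0 ≤ δ) (hη : 2 * δ ≤ η) {J : Finset ι} {j : ι}
    (hJT : 2 * (R - ρ) + 2 * η + 4 * δ + 2 * (J.card + 1) * δ ≤ T)
    (hJ : ∀ i ∈ J, ∀ g p, M i g p → spread o (X i) ≤ spread o (X j) + 2 * η)
    (hL : LinkBound M (fun p => p • o) o δ J) : IsolatedIndex M J j := by
  intro g g' p p' hp hp' hpp'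
  by_contra hne
  have hp1 := hM _ _ _ hp
  have hp1' := hM _ _ _ hp'
  obtain ⟨c, hc⟩ := h.exists_center o ⟨_, hp1.2.1⟩
  obtain ⟨hc1, hc2⟩ := hc g R (hR j g hp1.1)
  obtain ⟨hc1', hc2'⟩ := hc g' R (hR j g' hp1'.1)
  have hc1 := hc1 _ hp1.2.1
  have hc1' := hc1' _ hp1'.2.1
  rw [mul_inv_cancel_left] at hc1 hc1'
  have t1 := dist_triangle (p • o) (g • c) o
  have t1' := dist_triangle (p' • o) (g' • c) o
  have hh := hp1.2.2
  have hh' := hp1'.2.2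
  have a : ρ - spread o (X j) / 2 - η ≤ gromovProduct (g • c) (p • o) o := by
    unfold gromovProduct; rw [dist_comm (g • c) (p • o)]; linarith
  have a' : ρ - spread o (X j) / 2 - η ≤ gromovProduct (p' • o) (g' • c) o := by
    unfold gromovProduct; linarith
  have b := hL (ρ - spread o (X j) / 2 - η) (fun i hi γ q r hq hr => by
    have := hJ i hi γ q hq
    have hq := hM _ _ _ hq
    have hr := hM _ _ _ hr
    have := hq.dist_le hr
    have := hq.2.2
    have := hr.2.2
    simp only [gromovProduct]
    linarith) p p' hpp' (g' • c) a'
  have hJδ : 0 ≤ (J.card : ℝ) * δ := by positivity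
  have e := h.le_gromovProduct (a.trans' (by linarith)) b
  have f := dist_eq_sub_gromovProduct (g • c) (g' • c) o
  have k := hT (g'⁻¹ * g) (by simpa [inv_mul_eq_one, eq_comm] using hne) c
  rw [← dist_smul g', ← mul_smul, mul_inv_cancel_left] at k
  nlinarith

end Orbit

/-! ### Selecting a cluster of translates and a radius -/

section Core

open scoped Pointwise

variable {G H ι : Type*} [Group G] [MetricSpace H] [MulAction G H]

/-- The part of `HighMem` that is linked to the point `p₀`. -/
def ReachMem [Fintype ι] (X L : ι → Finset G) (o : H) (p₀ : G) (ρ : ℝ) (i : ι) (g p : G) : Prop :=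
  HighMem X L o ρ i g p ∧ Linked (HighMem X L o ρ) Finset.univ p₀ p

theorem ReachMem.of_mem [Fintype ι] {X L : ι → Finset G} {o : H} {p₀ : G} {ρ : ℝ} {i j : ι}
    {g g' p q : G} (h : ReachMem X L o p₀ ρ i g p) (hp : HighMem X L o ρ j g' p)
    (hq : HighMem X L o ρ j g' q) : ReachMem X L o p₀ ρ j g' q :=
  ⟨hq, h.2.tail ⟨j, Finset.mem_univ _, g', hp, hq⟩⟩

theorem ReachMem.linked [Fintype ι] {X L : ι → Finset G} {o : H} {p₀ : G} {ρ : ℝ} {i j : ι}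
    {g g' p q : G} (hp : ReachMem X L o p₀ ρ i g p) (hq : ReachMem X L o p₀ ρ j g' q) :
    Linked (ReachMem X L o p₀ ρ) Finset.univ p q := by
  have key : ∀ q, Linked (HighMem X L o ρ) Finset.univ p₀ q →
      Linked (ReachMem X L o p₀ ρ) Finset.univ p₀ q := by
    intro q hq
    induction hq with
    | refl => exact Relation.ReflTransGen.refl
    | tail hab hbc ih =>
      obtain ⟨i, hi, g, hb, hc⟩ := hbc
      exact ih.tail ⟨i, hi, g, ⟨hb, hab⟩, ⟨hc, hab.tail ⟨i, hi, g, hb, hc⟩⟩⟩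
  exact (key p hp.2).symm.trans (key q hq.2)

theorem ReachMem.mono [Fintype ι] {X L : ι → Finset G} {o : H} {p₀ : G} {ρ ρ' : ℝ} {i : ι}
    {g p : G} (hρ : ρ' ≤ ρ) (h : ReachMem X L o p₀ ρ i g p) : ReachMem X L o p₀ ρ' i g p := by
  have key : ∀ i g p, HighMem X L o ρ i g p → HighMem X L o ρ' i g p :=
    fun i g p h => ⟨h.1, h.2.1, hρ.trans_lt h.2.2⟩
  exact ⟨key _ _ _ h.1, h.2.mono subset_rfl key⟩

variable [IsIsometricSMul G H]

/-- In a finite nonempty family of translates `g X i`, `g ∈ L i`, one can select a subfamily `Z`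
and a radius `ρ` such that the subfamily is closed under sharing points outside the ball of radius
`ρ`, contains exactly one translate of `X i` for some `i`, and the part of its union inside the ball
has smaller diameter than `X i`. -/
theorem IsHyperbolicSpace.exists_subfamily [Fintype ι] {δ : ℝ} (h : IsHyperbolicSpace H δ)
    (hδ : 0 < δ) {N : ℕ} (hN : Fintype.card ι ≤ N)
    (hT : ∀ g : G, g ≠ 1 → ∀ p : H, (2 * (N : ℝ) + 11) ^ 2 * δ < dist (g • p) p)
    {X L : ι → Finset G} (o : H) (hX : ∀ i, (X i).Nonempty) (hL : ∃ i, (L i).Nonempty) :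
    ∃ (ρ : ℝ) (Z : ι → G → Prop) (i : ι) (g₀ : G),
      (∀ g, Z i g ↔ g = g₀) ∧ (∀ j g, Z j g → g ∈ L j) ∧
      (∀ j g j' g' p, Z j g → g' ∈ L j' → g⁻¹ * p ∈ X j → g'⁻¹ * p ∈ X j' →
        ρ < dist (p • o) o → Z j' g') ∧
      (∀ j g j' g' q q', Z j g → Z j' g' → g⁻¹ * q ∈ X j → g'⁻¹ * q' ∈ X j' →
        dist (q • o) o ≤ ρ → dist (q' • o) o ≤ ρ →
        dist (q • o) (q' • o) ≤ spread o (X i) - 2 * δ) := by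
  classical
  have hδ0 := hδ.le
  -- the top point
  obtain ⟨p₀, hp₀, hmax⟩ := (Finset.univ.biUnion fun i => L i * X i).exists_max_image
    (fun p => dist (p • o) o) (by
      obtain ⟨i, hi⟩ := hL
      exact Finset.Nonempty.mono (Finset.subset_biUnion_of_mem (fun i => L i * X i)
        (Finset.mem_univ i)) (hi.mul (hX i)))
  set R := dist (p₀ • o) o with hRdef
  have hR : ∀ i, ∀ g ∈ L i, ∀ a ∈ X i, dist ((g * a) • o) o ≤ R := fun i g hg a ha =>
    hmax _ (Finset.mem_biUnion.2 ⟨i, Finset.mem_univ _, Finset.mul_mem_mul hg ha⟩)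
  obtain ⟨i₀, g₁, hg₁, hp₁⟩ : ∃ i, ∃ g ∈ L i, g⁻¹ * p₀ ∈ X i := by
    obtain ⟨i, -, hi⟩ := Finset.mem_biUnion.1 hp₀
    obtain ⟨g, hg, a, ha, e⟩ := Finset.mem_mul.1 hi
    exact ⟨i, g, hg, by rwa [← e, inv_mul_cancel_left]⟩
  set d : ι → ℝ := fun i => spread o (X i) with hd
  -- `N * δ` pays for a chain through all indices; the remaining `4 * δ` covers the other uses of
  -- hyperbolicity and the final gain `2 * δ`. The levels `R - 2 * η * k` go up to `k = N + 1`,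
  -- hence a displacement bound quadratic in `N`.
  obtain ⟨η, hη⟩ : ∃ η, η = ((N : ℝ) + 4) * δ := ⟨_, rfl⟩
  have hη0 : 2 * δ ≤ η := by
    rw [hη]; have : (0 : ℝ) ≤ N := Nat.cast_nonneg _; nlinarith
  obtain ⟨M, hMdef⟩ : ∃ M : ℝ → ι → G → G → Prop, M = fun k => ReachMem X L o p₀ (R - 2 * η * k) :=
    ⟨_, rfl⟩
  have hM : ∀ k i g p, M k i g p → HighMem X L o (R - 2 * η * k) i g p := by
    intro k i g p hp; rw [hMdef] at hp; exact hp.1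
  have hM₀ : ∀ k : ℝ, 1 ≤ k → M k i₀ g₁ p₀ := by
    intro k hk
    rw [hMdef]
    refine ⟨⟨hg₁, hp₁, ?_⟩, Relation.ReflTransGen.refl⟩
    have : 0 < η * k := mul_pos (by linarith) (by linarith)
    linarith
  have hMM : ∀ k k', k ≤ k' → ∀ i g p, M k i g p → M k' i g p := by
    intro k k' hk i g p hp
    rw [hMdef] at hp ⊢
    exact hp.mono (by nlinarith)
  have hiso : ∀ k : ℝ, k ≤ N + 1 → ∀ (J : Finset ι) (j : ι),
      (∀ i ∈ J, ∀ g p, M k i g p → d i ≤ d j + 2 * η) →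
      LinkBound (M k) (fun p => p • o) o δ J → IsolatedIndex (M k) J j := by
    intro k hk J j hJ hL
    refine h.isolatedIndex hT hR (hM k) hδ0 hη0 ?_ hJ hL
    have hJN : (J.card : ℝ) ≤ N := by exact_mod_cast (Finset.card_le_univ J).trans hN
    have h1 : η * k ≤ η * (N + 1) := mul_le_mul_of_nonneg_left hk (by linarith)
    have h2 : (J.card : ℝ) * δ ≤ N * δ := mul_le_mul_of_nonneg_right hJN hδ0
    have hN0 : (0 : ℝ) ≤ N := Nat.cast_nonneg _
    have h3 : 0 ≤ (N : ℝ) * δ := by positivity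
    rw [hη] at h1 ⊢
    nlinarith
  have hLB : ∀ k : ℝ, k ≤ N + 1 → ∀ J, LinkBound (M k) (fun p => p • o) o δ J := by
    intro k hk J
    refine h.linkBound hδ0 d (fun J j hJ hL => hiso k hk J j (fun i hi g p _ => ?_) hL) J
    have := hJ i hi
    linarith
  have hlink : ∀ k i g p j g' q, M k i g p → M k j g' q → Linked (M k) Finset.univ p q := by
    intro k i g p j g' q hp hq
    rw [hMdef] at hp hq ⊢
    exact hp.linked hq
  have huniq : ∀ k : ℝ, k ≤ N + 1 → ∀ j g p g' p', M k j g p → M k j g' p' →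
      (∀ i g p, M k i g p → d i ≤ d j + 2 * η) → g = g' := by
    intro k hk j g p g' p' hp hp' hj
    exact hiso k hk Finset.univ j (fun i _ => hj i) (hLB k hk _) g g' p p' hp hp'
      (hlink _ _ _ _ _ _ _ hp hp')
  -- the choice of the radius
  obtain ⟨k, hk1, hkN, hk⟩ : ∃ k : ℝ, 1 ≤ k ∧ k ≤ N + 1 ∧ ∀ j g p, M k j g p →
      (∃ j' g' p', M k j' g' p' ∧ d j + 2 * η < d j') ∨
        ∃ q, g⁻¹ * q ∈ X j ∧ R - 2 * η * (k - 1) < dist (q • o) o := by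
    -- Otherwise each of `N + 1` levels has an almost largest set with no point above the previous
    -- level. Two levels `a < b` share an index; by uniqueness at level `b` the two translates
    -- agree, but the one from level `a` has a point too high for level `b`.
    by_contra! hcon
    have hcon' : ∀ a : Fin (N + 1), ∃ j g p, M (a + 1 : ℝ) j g p ∧
        (∀ j' g' p', M (a + 1 : ℝ) j' g' p' → d j' ≤ d j + 2 * η) ∧
        ∀ q, g⁻¹ * q ∈ X j → dist (q • o) o ≤ R - 2 * η * a := by
      intro a
      have ha : ((a : ℕ) : ℝ) + 1 ≤ N + 1 := by exact_mod_cast a.2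
      obtain ⟨j, g, p, h1, h2, h3⟩ := hcon ((a : ℕ) + 1) (by simp) ha
      exact ⟨j, g, p, h1, h2, fun q hq => by simpa using h3 q hq⟩
    choose j g p h1 h2 h3 using hcon'
    have key : ∀ a b : Fin (N + 1), a < b → j a ≠ j b := by
      intro a b hab hj
      have hab' : ((a : ℕ) : ℝ) + 1 ≤ b := by exact_mod_cast hab
      have hb : ((b : ℕ) : ℝ) + 1 ≤ N + 1 := by exact_mod_cast b.2
      have h1a := h1 a
      have h1a' := hMM _ _ (by linarith : ((a : ℕ) : ℝ) + 1 ≤ (b : ℕ) + 1) _ _ _ h1a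
      rw [hj] at h1a'
      have hg := huniq _ hb _ _ _ _ _ h1a' (h1 b) (h2 b)
      have h1a := hM _ _ _ _ h1a
      have := h3 b (p a) (by rw [← hj, ← hg]; exact h1a.2.1)
      have := h1a.2.2
      nlinarith
    obtain ⟨a, b, hab, hj⟩ := Fintype.exists_ne_map_eq_of_card_lt j (by simp; omega)
    rcases lt_or_gt_of_ne hab with hab | hab
    · exact key _ _ hab hj
    · exact key _ _ hab hj.symm
  -- the largest set of the subfamily
  obtain ⟨i, hi, himax⟩ := (Finset.univ.filter fun j => ∃ g p, M k j g p).exists_max_image d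
    ⟨i₀, by simpa using ⟨g₁, p₀, hM₀ k hk1⟩⟩
  obtain ⟨g₀, pi, hpi⟩ := (Finset.mem_filter.1 hi).2
  have himax : ∀ j g p, M k j g p → d j ≤ d i := fun j g p hp =>
    himax j (Finset.mem_filter.2 ⟨Finset.mem_univ _, g, p, hp⟩)
  set ρ := R - 2 * η * k with hρ
  have hmem : ∀ i g p j g' q, M k i g p → HighMem X L o ρ j g' p → HighMem X L o ρ j g' q →
      M k j g' q := by
    intro i g p j g' q hp h1 h2
    rw [hMdef] at hp ⊢
    exact hp.of_mem h1 h2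
  -- Either alternative in the choice of `k` gains `2 * η`: the set is that much shorter than the
  -- largest one, or it reaches that much above `ρ`.
  have hstar : ∀ j g p, M k j g p → ∃ P, M k j g P ∧
      d j - dist (P • o) o ≤ d i - 2 * η - ρ := by
    intro j g p hp
    rcases hk j g p hp with ⟨j', g', p', h1, h2⟩ | ⟨q, h1, h2⟩
    · have := himax _ _ _ h1
      have := (hM _ _ _ _ hp).2.2
      exact ⟨p, hp, by linarith⟩
    · have hp' := hM _ _ _ _ hp
      refine ⟨q, hmem _ _ _ _ _ _ hp hp' ⟨hp'.1, h1, ?_⟩, ?_⟩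
      · linarith
      · have := himax _ _ _ hp
        linarith
  have hhop : ∀ j g p q, M k j g p → M k j g q →
      ρ - d i / 2 + η - δ ≤ gromovProduct (p • o) (q • o) o := by
    intro j g p q hp hq
    obtain ⟨P, hP, hP'⟩ := hstar _ _ _ hp
    have hp := hM _ _ _ _ hp
    have hq := hM _ _ _ _ hq
    have hP := hM _ _ _ _ hP
    have h1 : _ ≤ d j := hp.dist_le hP
    have h2 : _ ≤ d j := hP.dist_le hq
    have := hp.2.2
    have := hq.2.2
    refine h.le_gromovProduct (y := P • o) ?_ ?_ <;> simp only [gromovProduct] <;>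
      linarith
  refine ⟨ρ, fun j g => ∃ p, M k j g p, i, g₀, ?_, ?_, ?_, ?_⟩
  · refine fun g => ⟨?_, ?_⟩
    · rintro ⟨p, hp⟩
      refine huniq k hkN i g p g₀ pi hp hpi fun j g p hp => ?_
      have := himax _ _ _ hp
      linarith
    · rintro rfl
      exact ⟨pi, hpi⟩
  · rintro j g ⟨p, hp⟩
    exact (hM _ _ _ _ hp).1
  · rintro j g j' g' p ⟨q, hq⟩ hg' h1 h2 h3
    have hq' := hM _ _ _ _ hq
    have := hmem _ _ _ _ _ _ hq hq' ⟨hq'.1, h1, h3⟩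
    exact ⟨p, hmem _ _ _ _ _ _ this ⟨hg', h2, h3⟩ ⟨hg', h2, h3⟩⟩
  · rintro j g j' g' q q' ⟨p, hp⟩ ⟨p', hp'⟩ hq hq' hqρ hqρ'
    obtain ⟨P, hP, hP1⟩ := hstar _ _ _ hp
    obtain ⟨P', hP', hP1'⟩ := hstar _ _ _ hp'
    -- Compare `q` with `q'` through `P` and `P'`. The chain leaves `⟨P, P'⟩ ≥ ρ - d i / 2 + 3 * δ`,
    -- and two more hyperbolic inequalities cost `2 * δ`; since `q` and `q'` are in the ball, the
    -- distance is at most `d i - 2 * δ`.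
    have hc := hLB k hkN Finset.univ _ (fun i _ g p q => hhop i g p q) P P'
      (hlink _ _ _ _ _ _ _ hP hP') (P' • o) (hhop _ _ _ _ hP' hP')
    have hcard : ((Finset.univ : Finset ι).card : ℝ) * δ ≤ N * δ :=
      mul_le_mul_of_nonneg_right (by exact_mod_cast hN) hδ0
    have hd1 : dist (q • o) (P • o) ≤ d j := by
      have := dist_le_spread o hq (hM _ _ _ _ hP).2.1
      rwa [mul_smul, mul_smul, dist_smul] at this
    have hd1' : dist (P' • o) (q' • o) ≤ d j' := by
      have := dist_le_spread o (hM _ _ _ _ hP').2.1 hq'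
      rwa [mul_smul, mul_smul, dist_smul] at this
    have e1 := dist_eq_sub_gromovProduct (q • o) (P • o) o
    have e2 := dist_eq_sub_gromovProduct (P' • o) (q' • o) o
    have e3 := dist_eq_sub_gromovProduct (q • o) (q' • o) o
    have f1 := h.gromov_ineq o (q • o) (P • o) (P' • o)
    have f2 := h.gromov_ineq o (q • o) (P' • o) (q' • o)
    have hη' : η = N * δ + 4 * δ := by rw [hη]; ring
    have hNδ : 0 ≤ (N : ℝ) * δ := by positivity
    rcases min_cases (gromovProduct (q • o) (P • o) o) (gromovProduct (P • o) (P' • o) o) with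
      hm | hm <;>
    rcases min_cases (gromovProduct (q • o) (P' • o) o) (gromovProduct (P' • o) (q' • o) o) with
      hm' | hm' <;>
    rw [hm.1] at f1 <;> rw [hm'.1] at f2 <;> linarith

end Core

/-! ### Reduction, zero divisors and units in the group algebra -/

section GroupAlgebra

variable {G H K : Type*} [Group G] [MetricSpace H] [MulAction G H] [IsIsometricSMul G H] [Field K]

open MonoidAlgebra

/-- A nontrivial left linear relation between nonzero elements of the group algebra allows to
replace one of them by a shorter combination. -/
theorem IsHyperbolicSpace.exists_reduction {ι : Type*} [Fintype ι] {δ : ℝ}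
    (h : IsHyperbolicSpace H δ) (hδ : 0 < δ) {N : ℕ} (hN : Fintype.card ι ≤ N)
    (hT : ∀ g : G, g ≠ 1 → ∀ p : H, (2 * (N : ℝ) + 11) ^ 2 * δ < dist (g • p) p) (o : H)
    {x l : ι → MonoidAlgebra K G} (hx : ∀ i, x i ≠ 0) (hl : ∃ i, l i ≠ 0)
    (hrel : ∑ i, l i * x i = 0) :
    ∃ (i : ι) (g : G) (k : K) (c : ι → MonoidAlgebra K G), k ≠ 0 ∧ c i = single g k ∧
      (∑ j, c j * x j = 0 ∨ spread o (∑ j, c j * x j).coeff.support ≤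
        spread o (x i).coeff.support - 2 * δ) := by
  classical
  obtain ⟨ρ, Z, i, g₀, hZi, hZL, hZc, hZd⟩ := h.exists_subfamily hδ hN hT
    (X := fun i => (x i).coeff.support) (L := fun i => (l i).coeff.support) o
    (fun i => Finsupp.support_nonempty_iff.2 (by simpa using hx i))
    (by obtain ⟨i, hi⟩ := hl; exact ⟨i, Finsupp.support_nonempty_iff.2 (by simpa using hi)⟩)
  have hcoeff : ∀ q, (∑ j, ofCoeff ((l j).coeff.filter (Z j)) * x j).coeff q =
      ∑ j, ∑ g ∈ (l j).coeff.support,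
        if Z j g then (l j).coeff g * (x j).coeff (g⁻¹ * q) else 0 := by
    intro q
    rw [coeff_sum, Finset.sum_apply']
    refine Finset.sum_congr rfl fun j _ => ?_
    rw [coeff_mul_apply_left, Finsupp.sum, Finset.sum_ite, Finset.sum_const_zero, add_zero]
    rw [coeff_ofCoeff, Finsupp.support_filter]
    refine Finset.sum_congr rfl fun g hg => ?_
    rw [Finsupp.filter_apply_pos _ _ (Finset.mem_filter.1 hg).2]
  have hrel' : ∀ q, ∑ j, ∑ g ∈ (l j).coeff.support,
      (l j).coeff g * (x j).coeff (g⁻¹ * q) = 0 := by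
    intro q
    have := congrArg (fun y => y.coeff q) hrel
    simp only [coeff_sum, Finset.sum_apply', coeff_mul_apply_left, Finsupp.sum, coeff_zero,
      Finsupp.zero_apply] at this
    exact this
  have hsupp : ∀ q, (∑ j, ofCoeff ((l j).coeff.filter (Z j)) * x j).coeff q ≠ 0 →
      dist (q • o) o ≤ ρ ∧ ∃ j g, Z j g ∧ g⁻¹ * q ∈ (x j).coeff.support := by
    intro q hq
    rw [hcoeff] at hq
    obtain ⟨j, -, hj⟩ := Finset.exists_ne_zero_of_sum_ne_zero hq
    obtain ⟨g, hg, hgj⟩ := Finset.exists_ne_zero_of_sum_ne_zero hj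
    have hZ : Z j g := by by_contra hn; simp [hn] at hgj
    rw [if_pos hZ] at hgj
    have hgx := Finsupp.mem_support_iff.2 (right_ne_zero_of_mul hgj)
    refine ⟨?_, j, g, hZ, hgx⟩
    -- At a point outside the ball, closure of `Z` puts every contributing term of the full relation
    -- into the partial sum, which is therefore zero there.
    by_contra! hcon
    refine hq ((Finset.sum_congr rfl fun j' _ => Finset.sum_congr rfl fun g' hg' => ?_).trans
      (hrel' q))
    by_cases h0 : (x j').coeff (g'⁻¹ * q) = 0
    · simp [h0]
    · rw [if_pos (hZc j g j' g' q hZ hg' hgx (Finsupp.mem_support_iff.2 h0) hcon)]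
  refine ⟨i, g₀, (l i).coeff g₀, fun j => ofCoeff ((l j).coeff.filter (Z j)),
    Finsupp.mem_support_iff.1 (hZL i g₀ ((hZi g₀).2 rfl)), ?_, ?_⟩
  · ext g
    rw [coeff_ofCoeff, coeff_single, Finsupp.filter_apply, Finsupp.single_apply]
    simp only [hZi]
    by_cases hg : g = g₀
    · simp [hg]
    · simp [hg, Ne.symm hg]
  · by_cases hy : ∑ j, ofCoeff ((l j).coeff.filter (Z j)) * x j = 0
    · exact Or.inl hy
    · refine Or.inr (spread_le o (Finsupp.support_nonempty_iff.2 (by rwa [Ne, coeff_eq_zero])) ?_)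
      intro a ha b hb
      obtain ⟨ha1, j, g, hg, hga⟩ := hsupp a (Finsupp.mem_support_iff.1 ha)
      obtain ⟨hb1, j', g', hg', hgb⟩ := hsupp b (Finsupp.mem_support_iff.1 hb)
      exact hZd j g j' g' a b hg hg' hga hgb ha1 hb1

/-- A product farthest from `o` is unique: if it lay in two translates `a • B` and `a' • B`, the
four-point inequality would put their centres within `6 * δ`. -/
theorem IsHyperbolicSpace.exists_uniqueMul {δ : ℝ} (h : IsHyperbolicSpace H δ)
    (hT : ∀ g : G, g ≠ 1 → ∀ p : H, 6 * δ < dist (g • p) p) (o : H) {A B : Finset G}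
    (hA : A.Nonempty) (hB : B.Nonempty) :
    ∃ a ∈ A, ∃ b ∈ B, UniqueMul A B a b ∧
      ∀ a' ∈ A, ∀ b' ∈ B, dist ((a' * b') • o) o ≤ dist ((a * b) • o) o := by
  obtain ⟨⟨a, b⟩, hab, hmax⟩ := (A ×ˢ B).exists_max_image
    (fun x => dist ((x.1 * x.2) • o) o) (hA.product hB)
  obtain ⟨ha, hb⟩ := Finset.mem_product.1 hab
  have hmax : ∀ a' ∈ A, ∀ b' ∈ B, dist ((a' * b') • o) o ≤ dist ((a * b) • o) o :=
    fun a' ha' b' hb' => hmax (a', b') (Finset.mem_product.2 ⟨ha', hb'⟩)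
  refine ⟨a, ha, b, hb, ?_, hmax⟩
  intro a' b' ha' hb' he
  suffices a' = a by
    subst this
    exact ⟨rfl, mul_left_cancel he⟩
  by_contra hne
  obtain ⟨c, hc⟩ := h.exists_center o hB
  obtain ⟨hc1, hc2⟩ := hc a _ (hmax a ha)
  obtain ⟨hc1', hc2'⟩ := hc a' _ (hmax a' ha')
  have hc1 := hc1 b hb
  have hc1' := hc1' b' hb'
  rw [he] at hc1'
  have h1 := h.dist_add_dist_le (a' • c) o (a • c) ((a * b) • o)
  rw [dist_comm o, dist_comm o, dist_comm (a • c) ((a * b) • o),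
    dist_comm (a' • c) ((a * b) • o)] at h1
  have h2 := hT (a⁻¹ * a') (by simpa [inv_mul_eq_one, eq_comm] using hne) c
  rw [← dist_smul a, ← mul_smul, mul_inv_cancel_left] at h2
  have := max_le (add_le_add hc2' hc1) (add_le_add hc2 hc1')
  linarith

theorem IsHyperbolicSpace.uniqueProds [Nonempty H] {δ : ℝ} (h : IsHyperbolicSpace H δ)
    (hT : ∀ g : G, g ≠ 1 → ∀ p : H, 6 * δ < dist (g • p) p) : UniqueProds G := by
  obtain ⟨o⟩ := ‹Nonempty H›
  refine ⟨fun {A B} hA hB => ?_⟩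
  obtain ⟨a, ha, b, hb, hab, -⟩ := h.exists_uniqueMul hT o hA hB
  exact ⟨a, ha, b, hb, hab⟩

/-- Elements of the group algebra with a left inverse are trivial units. -/
theorem IsHyperbolicSpace.eq_single_of_mul_eq_one [Nonempty H] {δ : ℝ}
    (h : IsHyperbolicSpace H δ) (hδ : 0 ≤ δ)
    (hT : ∀ g : G, g ≠ 1 → ∀ p : H, 6 * δ < dist (g • p) p) {a b : MonoidAlgebra K G}
    (hab : a * b = 1) : ∃ (g : G) (k : K), k ≠ 0 ∧ b = single g k := by
  classical
  obtain ⟨o⟩ := ‹Nonempty H›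
  have hA : a.coeff.support.Nonempty := Finsupp.support_nonempty_iff.2 (by
    rw [Ne, coeff_eq_zero]; rintro rfl; simp at hab)
  have hB : b.coeff.support.Nonempty := Finsupp.support_nonempty_iff.2 (by
    rw [Ne, coeff_eq_zero]; rintro rfl; simp at hab)
  obtain ⟨g, hg, q, hq, hgq, hmax⟩ := h.exists_uniqueMul hT o hA hB
  -- The unique farthest product has a nonzero coefficient in `a * b = 1`, so it is `1`. Then all
  -- products fix `o`, and the displacement bound forces them to be `1`.
  have h1 : g * q = 1 := by
    by_contra hne
    have := coeff_mul_mul_of_uniqueMul hgq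
    rw [hab, one_def, coeff_single, Finsupp.single_apply, if_neg (Ne.symm hne)] at this
    exact mul_ne_zero (Finsupp.mem_support_iff.1 hg) (Finsupp.mem_support_iff.1 hq) this.symm
  have h2 : ∀ q' ∈ b.coeff.support, q' = q := by
    intro q' hq'
    have h3 := hmax g hg q' hq'
    rw [h1, one_smul, dist_self] at h3
    by_contra hne
    have := hT (g * q') (fun h4 => hne (mul_left_cancel (h4.trans h1.symm))) o
    linarith
  refine ⟨q, b.coeff q, Finsupp.mem_support_iff.1 hq, ?_⟩
  ext x
  rw [coeff_single, Finsupp.single_apply]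
  split_ifs with hx
  · rw [hx]
  · by_contra hne
    exact hx (h2 x (Finsupp.mem_support_iff.2 hne)).symm

end GroupAlgebra

/-! ### Elementary and diagonal matrices as row operations -/

namespace Matrix

variable {m R : Type*} [Fintype m] [DecidableEq m] [Ring R]

/-- The elementary matrix with entry `c` at position `(i, j)`, as a unit. -/
def elementaryUnit (i j : m) (hij : i ≠ j) (c : R) : (Matrix m m R)ˣ where
  val := 1 + single i j c
  inv := 1 + single i j (-c)
  val_inv := by
    rw [add_mul, mul_add, mul_add, single_mul_single_of_ne _ _ _ _ hij.symm, one_mul, one_mul,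
      mul_one, add_zero, add_assoc, ← single_add, neg_add_cancel, single_zero, add_zero]
  inv_val := by
    rw [add_mul, mul_add, mul_add, single_mul_single_of_ne _ _ _ _ hij.symm, one_mul, one_mul,
      mul_one, add_zero, add_assoc, ← single_add, add_neg_cancel, single_zero, add_zero]

/-- The diagonal matrix with the unit `u` at position `(i, i)` and all other diagonal entries
equal to `1`. -/
def diagonalUnit (i : m) : Rˣ →* (Matrix m m R)ˣ :=
  Units.map ((diagonalRingHom m R).toMonoidHom.comp (MonoidHom.mulSingle (fun _ => R) i))

theorem elementaryUnit_mul_apply {i j : m} (hij : i ≠ j) (c : R) (M : Matrix m m R) (a b : m) :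
    ((elementaryUnit i j hij c : Matrix m m R) * M) a b =
      M a b + if a = i then c * M j b else 0 := by
  simp only [elementaryUnit, add_mul, one_mul, add_apply]
  split_ifs with h
  · rw [h, single_mul_apply_same]
  · rw [single_mul_apply_of_ne _ _ _ _ _ h]

theorem val_diagonalUnit (i : m) (u : Rˣ) :
    (diagonalUnit i u : Matrix m m R) = diagonal (Pi.mulSingle i (u : R)) := rfl

theorem diagonalUnit_mul_apply (i : m) (u : Rˣ) (M : Matrix m m R) (a b : m) :
    ((diagonalUnit i u : Matrix m m R) * M) a b = if a = i then u * M i b else M a b := by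
  rw [val_diagonalUnit, diagonal_mul]
  split_ifs with h
  · rw [h, Pi.mulSingle_eq_same]
  · rw [Pi.mulSingle_eq_of_ne h, one_mul]

theorem diagonalUnit_mul_elementaryUnit {i j : m} (hij : i ≠ j) (u : Rˣ) (c : R) :
    diagonalUnit i u * elementaryUnit i j hij c = elementaryUnit i j hij (u * c) * diagonalUnit i u := by
  ext a b
  rw [Units.val_mul, Units.val_mul, diagonalUnit_mul_apply, elementaryUnit_mul_apply,
    val_diagonalUnit]
  simp only [elementaryUnit, add_apply, single_apply, one_apply, diagonal_apply]
  have := hij.symm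
  by_cases h1 : a = i
  · subst h1
    by_cases h2 : a = b
    · subst h2; simp [this]
    · by_cases h3 : j = b
      · subst h3; simp [hij, this]
      · simp [h2, h3]
  · by_cases h2 : a = b
    · subst h2; simp [h1, Ne.symm h1]
    · simp [h1, h2, Ne.symm h1]

theorem elementaryUnit_add {i j : m} (hij : i ≠ j) (c d : R) :
    elementaryUnit i j hij (c + d) = elementaryUnit i j hij c * elementaryUnit i j hij d := by
  ext a b
  rw [Units.val_mul, elementaryUnit_mul_apply]
  simp only [elementaryUnit, add_apply, single_apply, one_apply]
  by_cases h1 : a = i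
  · subst h1
    by_cases h3 : j = b
    · subst h3; simp [hij, add_comm]
    · simp [h3, hij]
  · simp [h1, Ne.symm h1]

theorem elementaryUnit_zero {i j : m} (hij : i ≠ j) :
    elementaryUnit i j hij (0 : R) = 1 := by
  ext a b
  simp [elementaryUnit]

variable {P : Subgroup (Matrix m m R)ˣ}

theorem exists_mul_apply_eq_add_sum (hP : ∀ i j (hij : i ≠ j) (c : R), elementaryUnit i j hij c ∈ P)
    (i : m) (c : m → R) (s : Finset m) (hi : i ∉ s) :
    ∃ E ∈ P, ∀ (M : Matrix m m R) a b, ((E : Matrix m m R) * M) a b =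
      M a b + if a = i then ∑ j ∈ s, c j * M j b else 0 := by
  induction s using Finset.induction_on with
  | empty => exact ⟨1, P.one_mem, by simp⟩
  | insert j s hj ih =>
    rw [Finset.mem_insert, not_or] at hi
    obtain ⟨E, hE, h⟩ := ih hi.2
    refine ⟨elementaryUnit i j hi.1 (c j) * E, P.mul_mem (hP _ _ _ _) hE, fun M a b => ?_⟩
    rw [Units.val_mul, mul_assoc, elementaryUnit_mul_apply, h, h, if_neg (Ne.symm hi.1),
      Finset.sum_insert hj]
    split_ifs
    · rw [add_zero, add_assoc, add_comm (c j * M j b)]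
    · simp

theorem exists_mul_apply_eq_add_mul (hP : ∀ i j (hij : i ≠ j) (c : R), elementaryUnit i j hij c ∈ P)
    (k : m) (f : m → R) (s : Finset m) (hk : k ∉ s) :
    ∃ E ∈ P, ∀ (M : Matrix m m R) a b, ((E : Matrix m m R) * M) a b =
      M a b + if a ∈ s then f a * M k b else 0 := by
  induction s using Finset.induction_on with
  | empty => exact ⟨1, P.one_mem, by simp⟩
  | insert j s hj ih =>
    rw [Finset.mem_insert, not_or] at hk
    obtain ⟨E, hE, h⟩ := ih hk.2
    refine ⟨elementaryUnit j k (Ne.symm hk.1) (f j) * E, P.mul_mem (hP _ _ _ _) hE,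
      fun M a b => ?_⟩
    rw [Units.val_mul, mul_assoc, elementaryUnit_mul_apply, h, h, if_neg hk.2, add_zero]
    by_cases haj : a = j
    · subst haj
      simp [hj]
    · simp [haj]

variable {U : Subgroup Rˣ}

theorem exists_mul_apply_eq_sum (hP : ∀ i j (hij : i ≠ j) (c : R), elementaryUnit i j hij c ∈ P)
    (hU : ∀ i, ∀ u ∈ U, diagonalUnit i u ∈ P)
    (i : m) (c : m → R) {u : Rˣ} (hu : u ∈ U) (hc : c i = u) :
    ∃ E ∈ P, ∀ (M : Matrix m m R) a b, ((E : Matrix m m R) * M) a b =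
      if a = i then ∑ j, c j * M j b else M a b := by
  obtain ⟨E, hE, h⟩ := exists_mul_apply_eq_add_sum hP i c (Finset.univ.erase i)
    (Finset.notMem_erase _ _)
  refine ⟨E * diagonalUnit i u, P.mul_mem hE (hU i u hu), fun M a b => ?_⟩
  rw [Units.val_mul, mul_assoc, h, diagonalUnit_mul_apply]
  split_ifs with ha
  · rw [← Finset.add_sum_erase _ _ (Finset.mem_univ i), hc]
    congr 1
    refine Finset.sum_congr rfl fun j hj => ?_
    rw [diagonalUnit_mul_apply, if_neg (Finset.ne_of_mem_erase hj)]
  · rw [add_zero]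

end Matrix

/-! ### Gaussian elimination from the reduction property -/

section Elimination

open Matrix

variable {n : ℕ} {R : Type*} [Ring R]

/-- The first `k` columns of `A` are those of the identity matrix. -/
def Matrix.FirstColumnsEqOne (k : ℕ) (A : Matrix (Fin n) (Fin n) R) : Prop :=
  ∀ a b : Fin n, (b : ℕ) < k → A a b = (1 : Matrix (Fin n) (Fin n) R) a b

theorem Matrix.FirstColumnsEqOne.inv {k : ℕ} {A : (Matrix (Fin n) (Fin n) R)ˣ}
    (hA : FirstColumnsEqOne k (A : Matrix (Fin n) (Fin n) R)) :
    FirstColumnsEqOne k ((A⁻¹ : (Matrix (Fin n) (Fin n) R)ˣ) : Matrix (Fin n) (Fin n) R) := by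
  intro a b hb
  have h : ((A⁻¹ : (Matrix (Fin n) (Fin n) R)ˣ) * (A : Matrix (Fin n) (Fin n) R)) a b =
      (1 : Matrix (Fin n) (Fin n) R) a b := by rw [Units.inv_mul]
  rw [Matrix.mul_apply, Finset.sum_eq_single b] at h
  · rwa [hA b b hb, one_apply_eq, mul_one] at h
  · intro j _ hj
    rw [hA j b hb, one_apply_ne hj, mul_zero]
  · simp

variable [Nontrivial R] [NoZeroDivisors R] {P : Subgroup (Matrix (Fin n) (Fin n) R)ˣ}
  {U : Subgroup Rˣ}

/-- Induction on the total weight of column `k` from row `k` down. Rows from `k` on vanish in the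
earlier columns, so combining them leaves those columns intact. -/
theorem Matrix.FirstColumnsEqOne.exists_succ
    (hP : ∀ i j (hij : i ≠ j) (c : R), elementaryUnit i j hij c ∈ P)
    (hU : ∀ i, ∀ u ∈ U, diagonalUnit i u ∈ P) (w : R → ℕ)
    (hred : ∀ (s : Finset (Fin n)) (x l : Fin n → R), (∀ j ∈ s, x j ≠ 0) → (∃ j ∈ s, l j ≠ 0) →
      ∑ j ∈ s, l j * x j = 0 → ∃ i ∈ s, ∃ u ∈ U, ∃ c : Fin n → R, c i = (u : Rˣ) ∧
        w (∑ j ∈ s, c j * x j) < w (x i))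
    (hunit : ∀ a b : R, a * b = 1 → ∃ u ∈ U, (u : R) = b)
    (k : Fin n) (A : (Matrix (Fin n) (Fin n) R)ˣ)
    (hA : FirstColumnsEqOne (k : ℕ) (A : Matrix (Fin n) (Fin n) R)) :
    ∃ E ∈ P, FirstColumnsEqOne ((k : ℕ) + 1) ((E * A : (Matrix (Fin n) (Fin n) R)ˣ) :
      Matrix (Fin n) (Fin n) R) := by
  induction hμ : ∑ j ∈ Finset.Ici k, w ((A : Matrix (Fin n) (Fin n) R) j k) using
    Nat.strong_induction_on generalizing A with
  | _ μ ih =>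
  classical
  set B := ((A⁻¹ : (Matrix (Fin n) (Fin n) R)ˣ) : Matrix (Fin n) (Fin n) R) with hBdef
  have hB : FirstColumnsEqOne (k : ℕ) B := hA.inv
  set s := (Finset.Ici k).filter fun j => (A : Matrix (Fin n) (Fin n) R) j k ≠ 0 with hs
  have hsk : ∀ j ∈ s, k ≤ j := fun j hj => Finset.mem_Ici.1 (Finset.mem_filter.1 hj).1
  have hs0 : ∀ j ∈ s, (A : Matrix (Fin n) (Fin n) R) j k ≠ 0 :=
    fun j hj => (Finset.mem_filter.1 hj).2
  have hsum : ∀ a, k ≤ a → ∑ j ∈ s, B a j * (A : Matrix (Fin n) (Fin n) R) j k =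
      (1 : Matrix (Fin n) (Fin n) R) a k := by
    intro a ha
    have h : (B * (A : Matrix (Fin n) (Fin n) R)) a k = (1 : Matrix (Fin n) (Fin n) R) a k := by
      rw [hBdef, Units.inv_mul]
    rw [← h, Matrix.mul_apply]
    refine Finset.sum_subset (Finset.subset_univ _) fun j _ hj => ?_
    by_cases hjk : k ≤ j
    · have : (A : Matrix (Fin n) (Fin n) R) j k = 0 := by
        by_contra h0
        exact hj (Finset.mem_filter.2 ⟨Finset.mem_Ici.2 hjk, h0⟩)
      rw [this, mul_zero]
    · have hjk : j < k := not_le.1 hjk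
      rw [hB a j hjk, one_apply_ne (hjk.trans_le ha).ne', zero_mul]
  -- Row `a > k` of `A⁻¹` times column `k` of `A` is zero: this is the left relation fed to `hred`.
  by_cases hrel : ∃ a, k < a ∧ ∃ j ∈ s, B a j ≠ 0
  · obtain ⟨a, hka, hl⟩ := hrel
    obtain ⟨i, his, u, hu, c, hci, hw⟩ := hred s (fun j => (A : Matrix (Fin n) (Fin n) R) j k)
      (B a) hs0 hl (by rw [hsum a hka.le, one_apply_ne hka.ne'])
    obtain ⟨E, hE, h⟩ := exists_mul_apply_eq_sum hP hU i (fun j => if j ∈ s then c j else 0) hu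
      (by simp [his, hci])
    have hcs : ∀ (M : Matrix (Fin n) (Fin n) R) b,
        ∑ j, (if j ∈ s then c j else 0) * M j b = ∑ j ∈ s, c j * M j b := by
      intro M b
      simp [ite_mul, Finset.sum_ite_mem]
    simp only [hcs] at h
    have hEA : FirstColumnsEqOne (k : ℕ) ((E * A : (Matrix (Fin n) (Fin n) R)ˣ) :
        Matrix (Fin n) (Fin n) R) := by
      intro a b hb
      rw [Units.val_mul, h]
      split_ifs with ha
      · have hbi : b < i := lt_of_lt_of_le hb (hsk i his)
        rw [ha, one_apply_ne hbi.ne']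
        refine Finset.sum_eq_zero fun j hj => ?_
        rw [hA j b hb, one_apply_ne (show b < j from lt_of_lt_of_le hb (hsk j hj)).ne', mul_zero]
      · exact hA a b hb
    obtain ⟨E', hE', h'⟩ := ih _ (by
      rw [← hμ]
      refine Finset.sum_lt_sum (fun j _ => ?_) ⟨i, Finset.mem_Ici.2 (hsk i his), ?_⟩
      · rw [Units.val_mul, h]
        split_ifs with hj
        · rw [hj]; exact hw.le
        · exact le_rfl
      · rw [Units.val_mul, h, if_pos rfl]
        exact hw) (E * A) hEA rfl
    exact ⟨E' * E, P.mul_mem hE' hE, by rwa [mul_assoc]⟩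
  · push Not at hrel
    -- only one entry of the column is nonzero, and it is a unit
    have hone := hsum k le_rfl
    rw [one_apply_eq] at hone
    obtain ⟨i, his⟩ : s.Nonempty := by
      rw [Finset.nonempty_iff_ne_empty]
      intro h0
      rw [h0, Finset.sum_empty] at hone
      exact zero_ne_one hone
    -- Only the middle index `k` survives in `A * A⁻¹`. This rank-one block is an identity matrix,
    -- so in a domain it has size one.
    have hAB : ∀ j ∈ s, ∀ j' ∈ s, (A : Matrix (Fin n) (Fin n) R) j k * B k j' =
        (1 : Matrix (Fin n) (Fin n) R) j j' := by
      intro j hj j' hj'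
      have h : ((A : Matrix (Fin n) (Fin n) R) * B) j j' =
          (1 : Matrix (Fin n) (Fin n) R) j j' := by rw [hBdef, Units.mul_inv]
      rw [← h, Matrix.mul_apply, Finset.sum_eq_single k]
      · intro b _ hbk
        rcases lt_or_gt_of_ne hbk with hb | hb
        · rw [hA j b hb, one_apply_ne (show b < j from lt_of_lt_of_le hb (hsk j hj)).ne', zero_mul]
        · rw [hrel b hb j' hj', mul_zero]
      · simp
    have huniq : s = {i} := by
      rw [Finset.eq_singleton_iff_unique_mem]
      refine ⟨his, fun j hj => ?_⟩
      by_contra hne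
      have h1 := hAB j hj i his
      rw [one_apply_ne hne] at h1
      rcases mul_eq_zero.1 h1 with h2 | h2
      · exact hs0 j hj h2
      · have h3 := hAB i his i his
        rw [h2, mul_zero, one_apply_eq] at h3
        exact zero_ne_one h3
    rw [huniq, Finset.sum_singleton] at hone
    obtain ⟨u, hu, hui⟩ := hunit _ _ hone
    -- make the diagonal entry equal to one
    obtain ⟨E, hE, hEA, hEk⟩ : ∃ E ∈ P, FirstColumnsEqOne (k : ℕ)
        ((E * A : (Matrix (Fin n) (Fin n) R)ˣ) : Matrix (Fin n) (Fin n) R) ∧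
        ((E * A : (Matrix (Fin n) (Fin n) R)ˣ) : Matrix (Fin n) (Fin n) R) k k = 1 := by
      by_cases hik : i = k
      · subst hik
        refine ⟨diagonalUnit i u⁻¹, hU i _ (U.inv_mem hu), fun a b hb => ?_, ?_⟩
        · rw [Units.val_mul, diagonalUnit_mul_apply]
          split_ifs with ha
          · rw [ha, hA i b hb, one_apply_ne (show b < i from hb).ne', mul_zero]
          · exact hA a b hb
        · rw [Units.val_mul, diagonalUnit_mul_apply, if_pos rfl, ← hui, Units.inv_mul]
      · refine ⟨elementaryUnit k i (Ne.symm hik) ((u⁻¹ : Rˣ) : R), hP _ _ _ _,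
          fun a b hb => ?_, ?_⟩
        · rw [Units.val_mul, elementaryUnit_mul_apply, hA a b hb, hA i b hb,
            one_apply_ne (show b < i from lt_of_lt_of_le hb (hsk i his)).ne', mul_zero, ite_self, add_zero]
        · have hk0 : (A : Matrix (Fin n) (Fin n) R) k k = 0 := by
            by_contra h0
            have : k ∈ s := Finset.mem_filter.2 ⟨Finset.mem_Ici.2 le_rfl, h0⟩
            rw [huniq, Finset.mem_singleton] at this
            exact hik this.symm
          rw [Units.val_mul, elementaryUnit_mul_apply, if_pos rfl, ← hui, Units.inv_mul, hk0,
            zero_add]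
    obtain ⟨E', hE', h'⟩ := exists_mul_apply_eq_add_mul hP k
      (fun a => - ((E * A : (Matrix (Fin n) (Fin n) R)ˣ) : Matrix (Fin n) (Fin n) R) a k)
      (Finset.univ.erase k) (Finset.notMem_erase _ _)
    refine ⟨E' * E, P.mul_mem hE' hE, fun a b hb => ?_⟩
    rw [mul_assoc, Units.val_mul, h']
    rcases Nat.lt_succ_iff_lt_or_eq.1 hb with hb | hb
    · rw [hEA a b hb, hEA k b hb, one_apply_ne (show b < k from hb).ne', mul_zero, ite_self,
        add_zero]
    · obtain rfl : b = k := Fin.ext hb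
      rw [hEk]
      by_cases ha : a = b
      · rw [ha, hEk, one_apply_eq]; simp
      · simp [ha]

/-- Gaussian elimination over a domain with a weak form of a reduction theory. -/
theorem Matrix.subgroup_eq_top_of_reduction
    (hP : ∀ i j (hij : i ≠ j) (c : R), elementaryUnit i j hij c ∈ P)
    (hU : ∀ i, ∀ u ∈ U, diagonalUnit i u ∈ P) (w : R → ℕ)
    (hred : ∀ (s : Finset (Fin n)) (x l : Fin n → R), (∀ j ∈ s, x j ≠ 0) → (∃ j ∈ s, l j ≠ 0) →
      ∑ j ∈ s, l j * x j = 0 → ∃ i ∈ s, ∃ u ∈ U, ∃ c : Fin n → R, c i = (u : Rˣ) ∧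
        w (∑ j ∈ s, c j * x j) < w (x i))
    (hunit : ∀ a b : R, a * b = 1 → ∃ u ∈ U, (u : R) = b) : P = ⊤ := by
  rw [Subgroup.eq_top_iff']
  intro A
  have key : ∀ k ≤ n, ∃ E ∈ P, FirstColumnsEqOne k
      ((E * A : (Matrix (Fin n) (Fin n) R)ˣ) : Matrix (Fin n) (Fin n) R) := by
    intro k
    induction k with
    | zero => exact fun _ => ⟨1, P.one_mem, fun a b hb => absurd hb (Nat.not_lt_zero _)⟩
    | succ k ih =>
      intro hk
      obtain ⟨E, hE, h⟩ := ih (Nat.le_of_succ_le hk)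
      obtain ⟨E', hE', h'⟩ := FirstColumnsEqOne.exists_succ hP hU w hred hunit ⟨k, hk⟩ (E * A) h
      exact ⟨E' * E, P.mul_mem hE' hE, by rwa [mul_assoc]⟩
  obtain ⟨E, hE, h⟩ := key n le_rfl
  have h1 : E * A = 1 := by
    ext a b
    rw [h a b b.2, Units.val_one]
  rw [← inv_eq_of_mul_eq_one_right h1]
  exact P.inv_mem hE

end Elimination

/-! ### A finite generating set -/

section FiniteGeneration

open Matrix MonoidAlgebra

variable {G H K : Type*} [Group G] [MetricSpace H] [MulAction G H] [IsIsometricSMul G H] [Field K]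

/-- The subgroup of units of the group algebra generated by the scalars and the group elements. -/
noncomputable def trivialUnits (K G : Type*) [Field K] [Group G] : Subgroup (MonoidAlgebra K G)ˣ :=
  (Units.map (algebraMap K (MonoidAlgebra K G)).toMonoidHom).range ⊔
    ((Units.map (MonoidAlgebra.of K G)).comp (toUnits (G := G)).toMonoidHom).range

theorem exists_mem_trivialUnits (g : G) {k : K} (hk : k ≠ 0) :
    ∃ u ∈ trivialUnits K G, (u : MonoidAlgebra K G) = single g k := by
  refine ⟨Units.map (algebraMap K (MonoidAlgebra K G)).toMonoidHom (Units.mk0 k hk) *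
    Units.map (MonoidAlgebra.of K G) (toUnits g), Subgroup.mul_mem _
      (Subgroup.mem_sup_left ⟨_, rfl⟩) (Subgroup.mem_sup_right ⟨g, rfl⟩), ?_⟩
  rw [single_eq_algebraMap_mul_of]
  rfl

/-- A subgroup of `GL_n` of a group algebra containing the trivial diagonal units and the
elementary matrices with entry `1` contains all elementary matrices. -/
theorem elementaryUnit_mem {m : Type*} [Fintype m] [DecidableEq m]
    {P : Subgroup (Matrix m m (MonoidAlgebra K G))ˣ}
    (hU : ∀ i, ∀ u ∈ trivialUnits K G, diagonalUnit i u ∈ P) {i j : m} (hij : i ≠ j)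
    (h1 : elementaryUnit i j hij (1 : MonoidAlgebra K G) ∈ P) (c : MonoidAlgebra K G) :
    elementaryUnit i j hij c ∈ P := by
  induction c using MonoidAlgebra.induction_linear with
  | zero => rw [elementaryUnit_zero]; exact P.one_mem
  | add x y hx hy => rw [elementaryUnit_add]; exact P.mul_mem hx hy
  | single g k =>
    by_cases hk : k = 0
    · rw [hk, MonoidAlgebra.single_zero, elementaryUnit_zero]; exact P.one_mem
    · obtain ⟨u, hu, hug⟩ := exists_mem_trivialUnits g hk
      -- Conjugating the elementary matrix with entry `1` by `diagonalUnit i u` turns its entry into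
      -- `u`; sums of monomials follow by additivity.
      have := diagonalUnit_mul_elementaryUnit hij u 1
      rw [mul_one, hug] at this
      rw [eq_mul_inv_of_mul_eq this.symm]
      exact P.mul_mem (P.mul_mem (hU i u hu) h1) (P.inv_mem (hU i u hu))

theorem IsHyperbolicSpace.exists_weight [Nonempty H] {δ : ℝ} (h : IsHyperbolicSpace H δ)
    (hδ : 0 < δ) {n : ℕ}
    (hT : ∀ g : G, g ≠ 1 → ∀ p : H, (2 * (n : ℝ) + 11) ^ 2 * δ < dist (g • p) p) :
    ∃ w : MonoidAlgebra K G → ℕ, ∀ (s : Finset (Fin n)) (x l : Fin n → MonoidAlgebra K G),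
      (∀ j ∈ s, x j ≠ 0) → (∃ j ∈ s, l j ≠ 0) → ∑ j ∈ s, l j * x j = 0 →
      ∃ i ∈ s, ∃ u ∈ trivialUnits K G, ∃ c : Fin n → MonoidAlgebra K G,
        c i = (u : (MonoidAlgebra K G)ˣ) ∧ w (∑ j ∈ s, c j * x j) < w (x i) := by
  classical
  obtain ⟨o⟩ := ‹Nonempty H›
  -- A diameter drop of `2 * δ` lowers the floor by at least one; the `+ 1` makes replacement by
  -- zero a strict decrease as well.
  refine ⟨fun x => if x = 0 then 0 else ⌊spread o x.coeff.support / (2 * δ)⌋₊ + 1, ?_⟩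
  intro s x l hx ⟨j, hj, hlj⟩ hrel
  obtain ⟨⟨i, hi⟩, g, k, c, hk, hc, hlt⟩ := h.exists_reduction (ι := s) (N := n) hδ
    (by simpa using s.card_le_univ) hT o (x := fun j => x j) (l := fun j => l j)
    (fun j => hx j j.2) ⟨⟨j, hj⟩, hlj⟩ (by rw [← hrel, ← Finset.sum_coe_sort s])
  obtain ⟨u, hu, hug⟩ := exists_mem_trivialUnits g hk
  have hsum : ∑ j ∈ s, (if hj : j ∈ s then c ⟨j, hj⟩ else 0) * x j = ∑ j : s, c j * x j := by
    rw [← Finset.sum_coe_sort s]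
    refine Finset.sum_congr rfl fun j _ => ?_
    rw [dif_pos j.2]
  refine ⟨i, hi, u, hu, fun j => if hj : j ∈ s then c ⟨j, hj⟩ else 0, ?_, ?_⟩
  · simp only [dif_pos hi]
    rw [hc, hug]
  · beta_reduce
    rw [hsum, if_neg (hx i hi)]
    split_ifs with h0
    · exact Nat.succ_pos _
    · have h1 := hlt.resolve_left h0
      have h2 : spread o (∑ j : s, c j * x j).coeff.support / (2 * δ) + 1 ≤
          spread o (x i).coeff.support / (2 * δ) := by
        rw [div_add_one (by positivity), div_le_div_iff_of_pos_right (by positivity)]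
        linarith
      have h3 := Nat.floor_le_floor h2
      rw [Nat.floor_add_one (div_nonneg (spread_nonneg _ _) (by positivity))] at h3
      omega

theorem IsHyperbolicSpace.fg_generalLinearGroup [Finite K] [Group.FG G] [Nonempty H] {δ : ℝ}
    (h : IsHyperbolicSpace H δ) (hδ : 0 < δ) {n : ℕ}
    (hT : ∀ g : G, g ≠ 1 → ∀ p : H, (2 * (n : ℝ) + 11) ^ 2 * δ < dist (g • p) p) :
    Group.FG (Matrix.GeneralLinearGroup (Fin n) (MonoidAlgebra K G)) := by
  have hT' : ∀ g : G, g ≠ 1 → ∀ p : H, 6 * δ < dist (g • p) p := fun g hg p => by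
    refine lt_of_le_of_lt ?_ (hT g hg p)
    have : (0 : ℝ) ≤ n := n.cast_nonneg
    gcongr
    nlinarith
  -- Unique products make the group algebra a domain, as the elimination requires.
  have := h.uniqueProds hT'
  obtain ⟨w, hw⟩ := h.exists_weight (K := K) hδ hT
  obtain ⟨S, hS, hSfin⟩ := Group.fg_iff.1 ‹Group.FG G›
  set χ : Kˣ →* (MonoidAlgebra K G)ˣ := Units.map (algebraMap K (MonoidAlgebra K G)).toMonoidHom
    with hχ
  set ψ : G →* (MonoidAlgebra K G)ˣ :=
    (Units.map (MonoidAlgebra.of K G)).comp (toUnits (G := G)).toMonoidHom with hψ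
  let F : Set (Matrix (Fin n) (Fin n) (MonoidAlgebra K G))ˣ :=
    Set.range (fun p : {p : Fin n × Fin n // p.1 ≠ p.2} => elementaryUnit p.1.1 p.1.2 p.2 1) ∪
    (Set.range (fun p : Fin n × Kˣ => diagonalUnit p.1 (χ p.2)) ∪
      Set.range (fun p : Fin n × S => diagonalUnit p.1 (ψ p.2)))
  have : Finite S := hSfin
  have hF : F.Finite := (Set.finite_range _).union ((Set.finite_range _).union (Set.finite_range _))
  have hU : ∀ i, ∀ u ∈ trivialUnits K G, diagonalUnit i u ∈ Subgroup.closure F := by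
    intro i
    suffices trivialUnits K G ≤ (Subgroup.closure F).comap (diagonalUnit i) from this
    refine sup_le ?_ ?_
    · rintro _ ⟨k, rfl⟩
      exact Subgroup.subset_closure (Or.inr (Or.inl ⟨(i, k), rfl⟩))
    · change ψ.range ≤ _
      rw [MonoidHom.range_eq_map, Subgroup.map_le_iff_le_comap, ← hS, Subgroup.closure_le]
      exact fun g hg => Subgroup.subset_closure (Or.inr (Or.inr ⟨(i, ⟨g, hg⟩), rfl⟩))
  refine Group.fg_iff.2 ⟨F, Matrix.subgroup_eq_top_of_reduction
    (fun i j hij c => elementaryUnit_mem hU hij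
      (Subgroup.subset_closure (Or.inl ⟨⟨(i, j), hij⟩, rfl⟩)) c) hU w hw ?_, hF⟩
  intro a b hab
  obtain ⟨g, k, hk, rfl⟩ := h.eq_single_of_mul_eq_one hδ.le hT' hab
  exact exists_mem_trivialUnits g hk

end FiniteGeneration

theorem theorem1p6
    {K : Type*} [Field K] [Finite K]
    {G : Type*} [Group G] [Group.FG G]
    {H : Type*} [MetricSpace H] [Nonempty H] [MulAction G H] [IsIsometricSMul G H]
    (n : ℕ) (δ : ℝ) (hH : IsHyperbolicSpace H δ)
    (hdisp : ENNReal.ofReal ((2 * (n : ℝ) + 11) ^ 2 * δ) < minDisplacement G H) :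
    Group.FG (Matrix.GeneralLinearGroup (Fin n) (MonoidAlgebra K G)) := by
  obtain ⟨r, hr, hr'⟩ := ENNReal.lt_iff_exists_nnreal_btwn.1 hdisp
  have hn : (0 : ℝ) < (2 * (n : ℝ) + 11) ^ 2 := by positivity
  have hδ := hH.nonneg
  -- The strict displacement bound leaves room to enlarge `δ`, so that it becomes positive even when
  -- it was `0`; the weight divides by it.
  have hδr : δ < r / (2 * (n : ℝ) + 11) ^ 2 := by
    rw [lt_div_iff₀ hn, mul_comm]
    have := (ENNReal.ofReal_lt_iff_lt_toReal (by positivity) ENNReal.coe_ne_top).1 hr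
    simpa using this
  refine (hH.mono hδr.le).fg_generalLinearGroup (hδ.trans_lt hδr) fun g hg p => ?_
  rw [mul_div_cancel₀ _ hn.ne']
  have h1 : (r : ENNReal) < edist (g • p) p :=
    hr'.trans_le ((iInf₂_le g hg).trans (iInf_le _ p))
  rw [edist_nndist, ENNReal.coe_lt_coe] at h1
  exact_mod_cast h1
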